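/- Let the Euler polynomials $E_m(x)$, $m\ge 0$, be defined by the generating function $$\frac{2e^{xz}}{e^z+1}=\sum_{m=0}^\infty E_m(x)\,\frac{z^m}{m!}.$$ For a sequence $(c_k)_{k\ge 0}$ and $n\ge 0$ let $H_n(c_k)=\det\big(c_{i+j}\big)_{0\le i,j\le n}$ denote the $n$-th Hankel determinant (of size $n+1$), and let $\overline{\mathcal H}_n=\sum_{j=0}^{n}\frac{1}{2j+1}$. Then for every integer $n\ge 0$, with the sequence $c_k=E_{2k+5}(1)$, $k\geq 0$, $$H_n\big(E_{2k+5}(1)\big)=\left(\frac12\right)^{n+1}\,\overline{\mathcal H}_{n+1}\,\prod_{\ell=1}^{n+1}\left(\frac{\ell^2(2\ell+1)(2\ell-1)}{4}\right)^{n+2-\ell}.$$ -/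

import Mathlib

/-- The exponential generating function `2 e^{xz} / (e^z + 1)` of the Euler polynomials, as a formal
power series in `z` with coefficients in `ℚ[x]`. The constant coefficient of `e^z + 1` is `2`, so
the inverse taken in `ℚ⟦z⟧` is a true inverse. -/
noncomputable def eulerGenFun : PowerSeries (Polynomial ℚ) :=
  PowerSeries.map (Polynomial.C : ℚ →+* Polynomial ℚ) (2 * (PowerSeries.exp ℚ + 1)⁻¹) *
    PowerSeries.rescale (Polynomial.X : Polynomial ℚ) (PowerSeries.exp (Polynomial ℚ))

/-- The `n`-th Euler polynomial `E_n(x)`, given by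
`2 e^{xz} / (e^z + 1) = ∑_{n ≥ 0} E_n(x) z^n / n!`. -/
noncomputable def eulerPoly (n : ℕ) : Polynomial ℚ :=
  (n.factorial : Polynomial ℚ) * PowerSeries.coeff n eulerGenFun

/-- The Hankel determinant `H_n(c) = det (c_{i+j})_{0 ≤ i, j ≤ n}`, of size `n + 1`. -/
def hankelDet {R : Type*} [CommRing R] (n : ℕ) (c : ℕ → R) : R :=
  Matrix.det (Matrix.of fun i j : Fin (n + 1) => c (i.val + j.val))

/-- The sum of the odd reciprocals `∑_{j=0}^n 1 / (2j + 1)`. -/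
def oddHarmonic (n : ℕ) : ℚ :=
  ∑ j ∈ Finset.range (n + 1), 1 / (2 * (j : ℚ) + 1)

/-! With T = tanh(z/2), E_m(1) for m ≥ 1 is the m-th derivative of T at 0. Since T' = (1 - T²)/2,
that derivative is P_m(T) for a polynomial P_m. The derivation behind P_m is skew for `weightForm`,
so the matrix (E_{2(i+j)+1}(1)) is the Gram matrix of the P_{2i}. These are odd of degree 2i+1, so
it factors as L D Lᵀ with L lower triangular. The wanted determinant is its minor without row and
column 0, an adjugate entry. As P_{2i}(1) = δ_{i0}, L sends the all-ones vector to e₀, so this minor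
is det(L)² det(D) tr(D⁻¹); the trace gives the harmonic sum. -/

section EulerHankel

open Polynomial

/-- The derivation `p ↦ (1 - X²) / 2 * p'` of `ℚ[X]`: if `g' = (1 - g²) / 2`, then it corresponds to
differentiation of polynomials in `g`. -/
noncomputable def tanhDeriv : ℚ[X] →ₗ[ℚ] ℚ[X] :=
  LinearMap.mulLeft ℚ (C (1 / 2) * (1 - X ^ 2)) ∘ₗ Polynomial.derivative

theorem tanhDeriv_apply (p : ℚ[X]) :
    tanhDeriv p = C (1 / 2) * (1 - X ^ 2) * derivative p := rfl

theorem eval_one_tanhDeriv (p : ℚ[X]) : (tanhDeriv p).eval 1 = 0 := by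
  simp [tanhDeriv_apply]

theorem eval_zero_tanhDeriv (p : ℚ[X]) : (tanhDeriv p).eval 0 = p.coeff 1 / 2 := by
  simp [tanhDeriv_apply, ← coeff_zero_eq_eval_zero, coeff_derivative]
  ring

theorem coeff_tanhDeriv (p : ℚ[X]) (m : ℕ) :
    (tanhDeriv p).coeff (m + 1) = ((m + 2) * p.coeff (m + 2) - m * p.coeff m) / 2 := by
  have h : tanhDeriv p = C (1 / 2) * (derivative p - derivative p * X ^ 2) := by
    rw [tanhDeriv_apply]; ring
  rw [h, coeff_C_mul, coeff_sub, coeff_derivative, coeff_mul_X_pow']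
  rcases m with _ | m
  · norm_num; ring
  · simp [coeff_derivative]; ring

theorem coeff_zero_tanhDeriv (p : ℚ[X]) : (tanhDeriv p).coeff 0 = p.coeff 1 / 2 := by
  rw [coeff_zero_eq_eval_zero, eval_zero_tanhDeriv]

/-- The polynomials `P_n` with `dⁿ/dzⁿ tanh(z/2) = P_n(tanh(z/2))`. -/
noncomputable def tanhPoly (n : ℕ) : ℚ[X] := (tanhDeriv ^ n) X

theorem tanhPoly_zero : tanhPoly 0 = X := rfl

theorem tanhPoly_succ (n : ℕ) : tanhPoly (n + 1) = tanhDeriv (tanhPoly n) := by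
  rw [tanhPoly, pow_succ', Module.End.mul_apply, tanhPoly]

theorem coeff_tanhPoly_of_lt (n m : ℕ) (h : n + 1 < m) : (tanhPoly n).coeff m = 0 := by
  induction n generalizing m with
  | zero => rw [tanhPoly_zero, coeff_X, if_neg (by omega)]
  | succ n ih =>
    obtain ⟨m, rfl⟩ : ∃ k, m = k + 1 := ⟨m - 1, by omega⟩
    rw [tanhPoly_succ, coeff_tanhDeriv, ih _ (by omega), ih _ (by omega)]
    simp

theorem coeff_tanhPoly_of_even_add (n m : ℕ) (h : Even (n + m)) : (tanhPoly n).coeff m = 0 := by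
  induction n generalizing m with
  | zero =>
    rw [tanhPoly_zero, coeff_X, if_neg]
    rintro rfl
    exact absurd h (by decide)
  | succ n ih =>
    rcases m with _ | m
    · rw [tanhPoly_succ, coeff_zero_tanhDeriv, ih 1 h, zero_div]
    · rw [tanhPoly_succ, coeff_tanhDeriv, ih (m + 2) (by grind), ih m (by grind)]
      simp

theorem coeff_tanhPoly_top (n : ℕ) :
    (tanhPoly n).coeff (n + 1) = (-1 / 2) ^ n * (n.factorial : ℚ) := by
  induction n with
  | zero => simp [tanhPoly_zero]
  | succ n ih =>
    rw [tanhPoly_succ, coeff_tanhDeriv, ih, coeff_tanhPoly_of_lt _ _ (by omega),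
      Nat.factorial_succ]
    push_cast
    ring

/-- The bilinear form `⟨Xⁱ, Xʲ⟩ = δᵢⱼ i / 2` on `ℚ[X]`. -/
noncomputable def weightForm : ℚ[X] →ₗ[ℚ] ℚ[X] →ₗ[ℚ] ℚ :=
  Polynomial.lsum fun m =>
    LinearMap.toSpanSingleton ℚ (ℚ[X] →ₗ[ℚ] ℚ) (((m : ℚ) / 2) • Polynomial.lcoeff ℚ m)

theorem weightForm_monomial (m : ℕ) (a : ℚ) (q : ℚ[X]) :
    weightForm (monomial m a) q = a * (m / 2) * q.coeff m := by
  simp [weightForm, sum_monomial_index, mul_assoc]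

theorem weightForm_eq_sum (p q : ℚ[X]) (K : ℕ) (h : ∀ m, K ≤ m → p.coeff m = 0) :
    weightForm p q = ∑ m ∈ Finset.range K, p.coeff m * (m / 2) * q.coeff m := by
  have hp : p = ∑ m ∈ Finset.range K, monomial m (p.coeff m) := by
    ext k
    simp only [finsetSum_coeff, coeff_monomial, Finset.sum_ite_eq', Finset.mem_range]
    split_ifs with hk
    · rfl
    · exact h k (by omega)
  conv_lhs => rw [hp]
  simp [map_sum, weightForm_monomial]

theorem tanhDeriv_monomial (m : ℕ) (a : ℚ) :
    tanhDeriv (monomial m a) = monomial (m - 1) (a * m / 2) - monomial (m + 1) (a * m / 2) := by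
  rcases m with _ | m
  · simp [tanhDeriv_apply]
  · rw [tanhDeriv_apply, derivative_monomial, mul_sub, sub_mul, mul_one,
      ← monomial_one_right_eq_X_pow, C_mul_monomial, C_mul_monomial, monomial_mul_monomial,
      Nat.add_sub_cancel, mul_one, show 2 + m = m + 1 + 1 by ring,
      show 1 / 2 * (a * ((m + 1 : ℕ) : ℚ)) = a * ((m + 1 : ℕ) : ℚ) / 2 by ring]

/-- The weights i/2 are chosen for this: X^m and X^(m+1) couple with m(m+1)/4 up to sign, and the
sign flips when they swap roles. -/
theorem weightForm_tanhDeriv (p q : ℚ[X]) :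
    weightForm (tanhDeriv p) q = -weightForm p (tanhDeriv q) := by
  induction p using Polynomial.induction_on' with
  | add p₁ p₂ h₁ h₂ => simp only [map_add, LinearMap.add_apply, h₁, h₂]; ring
  | monomial m a =>
    rw [tanhDeriv_monomial, map_sub, LinearMap.sub_apply]
    simp only [weightForm_monomial]
    rcases m with _ | m
    · simp
    · rw [coeff_tanhDeriv]
      push_cast [Nat.add_sub_cancel]
      ring

theorem weightForm_X (p : ℚ[X]) : weightForm X p = p.coeff 1 / 2 := by
  rw [← monomial_one_one_eq_X, weightForm_monomial]
  push_cast
  ring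

theorem weightForm_tanhPoly (i n : ℕ) :
    weightForm (tanhPoly i) (tanhPoly n) = (-1) ^ i * ((tanhPoly (n + i + 1)).eval 0) := by
  induction i generalizing n with
  | zero => rw [tanhPoly_zero, weightForm_X, tanhPoly_succ, eval_zero_tanhDeriv]; simp
  | succ i ih =>
    rw [tanhPoly_succ i, weightForm_tanhDeriv, ← tanhPoly_succ, ih,
      show n + 1 + i + 1 = n + (i + 1) + 1 by ring]
    ring

theorem sum_range_odd {M : Type*} [AddCommMonoid M] (f : ℕ → M) (N : ℕ)
    (h : ∀ m, Even m → f m = 0) :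
    ∑ m ∈ Finset.range (2 * N), f m = ∑ k ∈ Finset.range N, f (2 * k + 1) := by
  induction N with
  | zero => simp
  | succ N ih =>
    rw [show 2 * (N + 1) = 2 * N + 1 + 1 by ring, Finset.sum_range_succ, Finset.sum_range_succ, ih,
      Finset.sum_range_succ, h (2 * N) (by simp), add_zero]

theorem sum_coeff_tanhPoly_mul (N i j : ℕ) (hi : i < N) :
    ∑ k ∈ Finset.range N, (tanhPoly (2 * i)).coeff (2 * k + 1) * ((2 * k + 1) / 2) *
      (tanhPoly (2 * j)).coeff (2 * k + 1) = (tanhPoly (2 * (i + j) + 1)).eval 0 := by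
  have h := weightForm_tanhPoly (2 * i) (2 * j)
  rw [weightForm_eq_sum _ _ (2 * N) fun m hm => coeff_tanhPoly_of_lt _ _ (by omega),
    sum_range_odd _ _ fun m hm => by
      rw [coeff_tanhPoly_of_even_add _ _ (by simp [Nat.even_add, hm]), zero_mul, zero_mul],
    pow_mul, neg_one_sq, one_pow, one_mul, show 2 * j + 2 * i + 1 = 2 * (i + j) + 1 by ring] at h
  rw [← h]
  exact Finset.sum_congr rfl fun k _ => by push_cast; ring

/-- The sum is P_{2i}(1), which vanishes for i > 0 because of the factor 1 - X² in `tanhDeriv`. -/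
theorem sum_coeff_tanhPoly (N i : ℕ) (hi : i < N) :
    ∑ k ∈ Finset.range N, (tanhPoly (2 * i)).coeff (2 * k + 1) = if i = 0 then 1 else 0 := by
  rw [← sum_range_odd (fun m => (tanhPoly (2 * i)).coeff m) N fun m hm =>
    coeff_tanhPoly_of_even_add _ _ (by simp [Nat.even_add, hm])]
  have hdeg : (tanhPoly (2 * i)).natDegree < 2 * N :=
    lt_of_le_of_lt (natDegree_le_iff_coeff_eq_zero.2 fun m hm => coeff_tanhPoly_of_lt (2 * i) m hm)
      (by omega)
  have h := eval_eq_sum_range' hdeg (1 : ℚ)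
  simp only [one_pow, mul_one] at h
  rw [← h]
  rcases i with _ | i
  · simp [tanhPoly_zero]
  · rw [show 2 * (i + 1) = 2 * i + 1 + 1 by ring, tanhPoly_succ, eval_one_tanhDeriv,
      if_neg (by omega)]

/-! ### Link with the Euler generating function -/

/-- The power series `tanh(z/2) = 2 e^z / (e^z + 1) - 1`. -/
noncomputable def tanhHalf : PowerSeries ℚ :=
  2 * (PowerSeries.exp ℚ + 1)⁻¹ * PowerSeries.exp ℚ - 1

theorem constantCoeff_exp_add_one_ne_zero :
    PowerSeries.constantCoeff (PowerSeries.exp ℚ + 1) ≠ 0 := by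
  simp

theorem tanhHalf_mul : tanhHalf * (PowerSeries.exp ℚ + 1) = PowerSeries.exp ℚ - 1 := by
  have h := PowerSeries.inv_mul_cancel _ constantCoeff_exp_add_one_ne_zero
  rw [tanhHalf]
  linear_combination 2 * PowerSeries.exp ℚ * h

theorem constantCoeff_tanhHalf : PowerSeries.constantCoeff tanhHalf = 0 := by
  have h := congrArg PowerSeries.constantCoeff tanhHalf_mul
  rw [map_mul] at h
  simpa [constantCoeff_exp_add_one_ne_zero] using h

theorem derivative_tanhHalf :
    2 * PowerSeries.derivative ℚ tanhHalf = 1 - tanhHalf ^ 2 := by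
  have hexp : PowerSeries.derivative ℚ (PowerSeries.exp ℚ) = PowerSeries.exp ℚ :=
    PowerSeries.derivative_exp ℚ
  have h := congrArg (PowerSeries.derivative ℚ) tanhHalf_mul
  simp only [Derivation.leibniz, map_add, map_sub, Derivation.map_one_eq_zero, hexp,
    smul_eq_mul, add_zero, sub_zero] at h
  have hne : PowerSeries.exp ℚ + 1 ≠ 0 := fun h0 =>
    constantCoeff_exp_add_one_ne_zero (by rw [h0, map_zero])
  have h2 := tanhHalf_mul
  apply mul_right_cancel₀ (pow_ne_zero 2 hne)
  linear_combination 2 * (PowerSeries.exp ℚ + 1) * h +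
    (tanhHalf * (PowerSeries.exp ℚ + 1) - PowerSeries.exp ℚ - 1) * h2

theorem aeval_tanhHalf_tanhDeriv (p : ℚ[X]) :
    aeval tanhHalf (tanhDeriv p) = PowerSeries.derivative ℚ (aeval tanhHalf p) := by
  have h2 : aeval tanhHalf (C (1 / 2 : ℚ)) * (2 : PowerSeries ℚ) = 1 := by
    rw [show (2 : PowerSeries ℚ) = aeval tanhHalf (C (2 : ℚ)) by
      rw [aeval_C, map_ofNat], ← map_mul, ← C_mul]
    norm_num
  rw [Derivation.map_aeval, tanhDeriv_apply, map_mul, map_mul, map_sub, map_one, map_pow, aeval_X,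
    ← derivative_tanhHalf, smul_eq_mul]
  linear_combination (PowerSeries.derivative ℚ tanhHalf) * aeval tanhHalf (derivative p) * h2

theorem aeval_tanhHalf_tanhPoly (n : ℕ) :
    aeval tanhHalf (tanhPoly n) = (PowerSeries.derivative ℚ)^[n] tanhHalf := by
  induction n with
  | zero => simp [tanhPoly_zero]
  | succ n ih => rw [tanhPoly_succ, aeval_tanhHalf_tanhDeriv, ih, Function.iterate_succ_apply']

theorem eval_zero_tanhPoly (n : ℕ) :
    (tanhPoly n).eval 0 = n.factorial * PowerSeries.coeff n tanhHalf := by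
  have h (p : ℚ[X]) : PowerSeries.constantCoeff (aeval tanhHalf p) = p.eval 0 := by
    rw [aeval_def, hom_eval₂, constantCoeff_tanhHalf,
      show (PowerSeries.constantCoeff (R := ℚ)).comp (algebraMap ℚ (PowerSeries ℚ)) = RingHom.id ℚ
        from RingHom.ext fun _ => by simp, eval₂_id]
  rw [← h, aeval_tanhHalf_tanhPoly, PowerSeries.constantCoeff_iterate_derivative]

theorem eval_one_eulerPoly_succ (m : ℕ) :
    (eulerPoly (m + 1)).eval 1 = (tanhPoly (m + 1)).eval 0 := by
  have hmap : PowerSeries.map (Polynomial.evalRingHom (1 : ℚ)) eulerGenFun = tanhHalf + 1 := by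
    have hC : (evalRingHom (1 : ℚ)).comp C = RingHom.id ℚ := RingHom.ext fun _ => by simp
    have hexp : PowerSeries.map (evalRingHom (1 : ℚ))
        (PowerSeries.rescale (X : ℚ[X]) (PowerSeries.exp ℚ[X])) = PowerSeries.exp ℚ := by
      ext k
      rw [PowerSeries.coeff_map, PowerSeries.coeff_rescale, map_mul, map_pow, coe_evalRingHom,
        eval_X, one_pow, one_mul, PowerSeries.coeff_exp, PowerSeries.coeff_exp]
      simp
    rw [eulerGenFun, map_mul, hexp, ← RingHom.comp_apply, ← PowerSeries.map_comp, hC, tanhHalf]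
    simp
  rw [eval_zero_tanhPoly, eulerPoly, eval_mul]
  have := congrArg (PowerSeries.coeff (m + 1)) hmap
  rw [PowerSeries.coeff_map, map_add, PowerSeries.coeff_one, if_neg (by omega), add_zero] at this
  rw [← this]
  simp

/-! ### Determinant evaluation -/

theorem adjugate_zero_zero_of_mulVec_one {N : ℕ} (L : Matrix (Fin (N + 1)) (Fin (N + 1)) ℚ)
    (w : Fin (N + 1) → ℚ) (hw : ∀ k, w k ≠ 0) (hL : L.mulVec 1 = Pi.single 0 1) :
    (L * Matrix.diagonal w * L.transpose).adjugate 0 0 =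
      L.det ^ 2 * (∏ k, w k) * ∑ k, (w k)⁻¹ := by
  -- Applying adj(L) to L·1 = e₀ shows that its column 0 is constant.
  have h1 : ∀ k, L.adjugate k 0 = L.det := fun k => by
    have := congrFun (congrArg L.adjugate.mulVec hL) k
    rw [Matrix.mulVec_mulVec, Matrix.adjugate_mul] at this
    simpa [Matrix.smul_mulVec] using this.symm
  have h2 : (Matrix.diagonal w).adjugate = Matrix.diagonal fun k => (∏ k, w k) * (w k)⁻¹ := by
    rw [Matrix.adjugate_diagonal]
    congr 1
    ext k
    rw [← Finset.mul_prod_erase _ w (Finset.mem_univ k), mul_comm (w k), mul_assoc,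
      mul_inv_cancel₀ (hw k), mul_one]
  rw [Matrix.adjugate_mul_distrib, Matrix.adjugate_mul_distrib, h2, ← Matrix.adjugate_transpose,
    Matrix.mul_apply]
  simp only [Matrix.transpose_apply, h1, Matrix.diagonal_mul, Finset.mul_sum]
  exact Finset.sum_congr rfl fun k _ => by ring

/-- The k-th factor is half of r₁⋯r_k, so r_l occurs once for each k from l to N. -/
theorem prod_factorial_weight (N : ℕ) :
    (∏ k ∈ Finset.range (N + 1), (-1 / 2 : ℚ) ^ (2 * k) * ((2 * k).factorial : ℚ)) ^ 2 *
      ∏ k ∈ Finset.range (N + 1), ((2 * (k : ℚ) + 1) / 2) =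
    (1 / 2) ^ (N + 1) * ∏ l ∈ Finset.Icc 1 N,
      ((l : ℚ) ^ 2 * (2 * (l : ℚ) + 1) * (2 * (l : ℚ) - 1) / 4) ^ (N + 1 - l) := by
  set r : ℕ → ℚ := fun l => (l : ℚ) ^ 2 * (2 * (l : ℚ) + 1) * (2 * (l : ℚ) - 1) / 4 with hr
  have hk : ∀ k : ℕ, ((-1 / 2 : ℚ) ^ (2 * k) * ((2 * k).factorial : ℚ)) ^ 2 *
      ((2 * (k : ℚ) + 1) / 2) = 1 / 2 * ∏ l ∈ Finset.Icc 1 k, r l := by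
    intro k
    induction k with
    | zero => simp
    | succ k ih =>
      rw [Finset.prod_Icc_succ_top (by omega), ← mul_assoc, ← ih,
        show 2 * (k + 1) = 2 * k + 1 + 1 by ring, Nat.factorial_succ, Nat.factorial_succ, hr]
      push_cast
      ring
  rw [← Finset.prod_pow, ← Finset.prod_mul_distrib, Finset.prod_congr rfl fun k _ => hk k]
  induction N with
  | zero => simp
  | succ N ih =>
    rw [Finset.prod_range_succ, ih]
    have hs : ∏ l ∈ Finset.Icc 1 (N + 1), r l ^ (N + 1 + 1 - l) =
        (∏ l ∈ Finset.Icc 1 N, r l ^ (N + 1 - l)) * ∏ l ∈ Finset.Icc 1 (N + 1), r l := by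
      have h0 : ∏ l ∈ Finset.Icc 1 N, r l ^ (N + 1 - l) =
          ∏ l ∈ Finset.Icc 1 (N + 1), r l ^ (N + 1 - l) := by
        rw [Finset.prod_Icc_succ_top (by omega)]; simp
      rw [h0, ← Finset.prod_mul_distrib]
      refine Finset.prod_congr rfl fun l hl => ?_
      rw [Finset.mem_Icc] at hl
      rw [← pow_succ, show N + 1 - l + 1 = N + 1 + 1 - l by omega]
    rw [hs]
    ring

end EulerHankel

theorem proposition5p1 (n : ℕ) :
    hankelDet n (fun k : ℕ => (eulerPoly (2 * k + 5)).eval 1) =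
      (1 / 2 : ℚ) ^ (n + 1) * oddHarmonic (n + 1) *
        ∏ l ∈ Finset.Icc 1 (n + 1),
          ((l : ℚ) ^ 2 * (2 * (l : ℚ) + 1) * (2 * (l : ℚ) - 1) / 4) ^ (n + 2 - l) := by
  set L : Matrix (Fin (n + 2)) (Fin (n + 2)) ℚ :=
    Matrix.of fun i k => (tanhPoly (2 * i)).coeff (2 * k + 1)
  set w : Fin (n + 2) → ℚ := fun k => (2 * (k : ℚ) + 1) / 2
  have hM : L * Matrix.diagonal w * L.transpose =
      Matrix.of fun i j : Fin (n + 2) => (eulerPoly (2 * (i + j : ℕ) + 1)).eval 1 := by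
    ext i j
    rw [Matrix.mul_apply, Matrix.of_apply, eval_one_eulerPoly_succ,
      ← sum_coeff_tanhPoly_mul (n + 2) i j i.2, Finset.sum_range]
    simp [L, w, Matrix.mul_diagonal]
  have hL1 : L.mulVec 1 = Pi.single 0 1 := by
    ext i
    have := sum_coeff_tanhPoly (n + 2) i i.2
    rw [Finset.sum_range] at this
    simpa only [L, Matrix.mulVec, dotProduct, Matrix.of_apply, Pi.one_apply, mul_one,
      Pi.single_apply, Fin.ext_iff, Fin.val_zero] using this
  have hdet : L.det = ∏ k ∈ Finset.range (n + 2),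
      (-1 / 2 : ℚ) ^ (2 * k) * ((2 * k).factorial : ℚ) := by
    rw [Matrix.det_of_isLowerTriangular, Finset.prod_range]
    · exact Finset.prod_congr rfl fun k _ => coeff_tanhPoly_top _
    · intro i j hij
      have hij : (i : ℕ) < j := hij
      exact coeff_tanhPoly_of_lt _ _ (by omega)
  -- Deleting row and column 0 raises i + j by 2, turning index 2(i+j)+1 into 2(i+j)+5.
  have hH : hankelDet n (fun k : ℕ => (eulerPoly (2 * k + 5)).eval 1) =
      (L * Matrix.diagonal w * L.transpose).adjugate 0 0 := by
    rw [hM, Matrix.adjugate_fin_succ_eq_det_submatrix, hankelDet]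
    simp only [Fin.val_zero, add_zero, pow_zero, one_mul]
    congr 1
    ext i j
    simp only [Matrix.of_apply, Matrix.submatrix_apply, Fin.succAbove_zero, Fin.val_succ]
    congr 2
    ring
  have hsum : ∑ k, (w k)⁻¹ = 2 * oddHarmonic (n + 1) := by
    rw [oddHarmonic, Finset.sum_range, Finset.mul_sum]
    exact Finset.sum_congr rfl fun k _ => by simp [w, div_eq_mul_inv]
  have hprod : ∏ k, w k = ∏ k ∈ Finset.range (n + 2), ((2 * (k : ℚ) + 1) / 2) := by
    rw [Finset.prod_range]
  rw [hH, adjugate_zero_zero_of_mulVec_one L w (fun k => by positivity) hL1, hdet, hsum, hprod,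
    prod_factorial_weight (n + 1)]
  ring
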